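/- Let $G$ be a finite group and $\omega\colon G^3\to\mathbb C^\times$ a normalized three-cocycle. Write $g\triangleright x=gxg^{-1}$, $[x,y]=xyx^{-1}y^{-1}$, $\overline g$ for the conjugacy class and $C_G(g)$ for the centralizer of $g$. Let $\mathrm{Vec}_G^\omega$ be the category of finite-dimensional $G$-graded complex vector spaces with associativity constraint $(u\otimes v)\otimes w\mapsto\omega(|u|,|v|,|w|)\,u\otimes(v\otimes w)$, and let $\mathcal Z(\mathrm{Vec}_G^\omega)$ be its (right) Drinfeld center. An object $W$ of the center has half-braidings $\sigma_{V,W}\colon V\otimes W\to W\otimes V$, $v\otimes w\mapsto |v|\triangleright w\otimes v$, and these also give the braiding $\sigma$ of the center. A simple object corresponds to $(g,\chi)$ if the degrees of its nonzero homogeneous components form $\overline g$ and $\chi\colon C_G(g)\to\mathbb C$ is the (projective) character of $C_G(g)$ acting by $\triangleright$ on the component of degree $g$. For simple objects $U,V,W$ corresponding to $(g,\chi_1),(h,\chi_2),(k,\chi_3)$, let $$B_{(g,\chi_1),(h,\chi_2),(k,\chi_3)}=\mathrm{tr}\bigl((\sigma_2^{-1}\sigma_1)^3\bigr)$$ be the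 trace of the Borromean braid acting on $(U\otimes V)\otimes W$ (associativity isomorphisms inserted). Put $$\alpha_g(x,y)=\omega(x,y,g)\,\omega(x,y\triangleright g,y)^{-1}\,\omega(xy\triangleright g,x,y),\qquad \psi(x,x',y,z)=\omega(y,z,x')^{-1}\,\omega(y,x,z)\,\alpha_x(z,z^{-1})^{-1},$$ $$\Omega(x,y,z)=\psi(x,z^{-1}\triangleright x,x\triangleright y,z)\;\psi(x\triangleright y,y,y\triangleright z,z^{-1}\triangleright x)\;\psi(y\triangleright z,z,x,y).$$ **Proposition.** Suppose $A\triangleleft G$ is an abelian normal subgroup such that $\omega$ is inflated from $G/A$ (it is the pull-back of a normalized three-cocycle of $G/A$), and $g,h\in A$. For $x\in\overline g$ and $y\in\overline h$ choose $p=p_x$ and $q=q_y$ in $G$ with $p\triangleright g=x$ and $q\triangleright h=y$. Then: 1. $\chi_1$ and $\chi_2$ are ordinary characters: the action $\triangleright$ of $C_G(g)$ on $U_g$ and that of $C_G(h)$ on $V_h$ are linear representations, with characters $\chi_1$ and $\chi_2$. 2. For all $x\in\overline g$, $y\in\overline h$ the commutator conditions $[[k,y],x]=1$ and $[[y^{-1},x],k]=1$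 hold, and all cocycle terms are trivial: $\Omega(x,y,k)=1$; $\alpha_y((k^{-1}\triangleright x)^{-1},x)=\alpha_x(y\triangleright k,k^{-1})=\alpha_k(y^{-1},x\triangleright y)=1$; $\alpha_g([y,k],p)=\alpha_g(p,p^{-1}\triangleright[y,k])=1$; $\alpha_h([k^{-1},x^{-1}],q)=\alpha_h(q,q^{-1}\triangleright[k^{-1},x^{-1}])=1$. 3. For all $x\in\overline g$, $y\in\overline h$ one has $p^{-1}\triangleright[y,k]\in C_G(g)$ and $q^{-1}\triangleright[k^{-1},x^{-1}]\in C_G(h)$, and $$B_{(g,\chi_1),(h,\chi_2),(k,\chi_3)}=|\overline k|\,\chi_3(1)\sum_{x\in\overline g,\;y\in\overline h}\chi_1\bigl(p^{-1}\triangleright[y,k]\bigr)\,\chi_2\bigl(q^{-1}\triangleright[k^{-1},x^{-1}]\bigr).$$ -/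

import Mathlib

open CategoryTheory MonoidalCategory TensorProduct
open scoped commutatorElement

noncomputable section

universe u

/-- A normalized three-cocycle `G × G × G → ℂˣ` (trivial coefficients). -/
structure ThreeCocycle (G : Type u) [Group G] where
  toFun : G → G → G → ℂˣ
  cocycle : ∀ a b c d : G,
    toFun b c d * toFun a (b * c) d * toFun a b c = toFun (a * b) c d * toFun a b (c * d)
  one_left : ∀ b c : G, toFun 1 b c = 1
  one_mid : ∀ a c : G, toFun a 1 c = 1
  one_right : ∀ a b : G, toFun a b 1 = 1

namespace ThreeCocycle

variable {G : Type u} [Group G]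

instance : CoeFun (ThreeCocycle G) (fun _ => G → G → G → ℂˣ) := ⟨toFun⟩

/-- `ω` is inflated from `G ⧸ A`: it is the pull-back of a three-cocycle of `G ⧸ A` along the
canonical projection. -/
def IsInflatedFrom (ω : ThreeCocycle G) (A : Subgroup G) [A.Normal] : Prop :=
  ∃ ω' : ThreeCocycle (G ⧸ A), ∀ x y z : G, ω x y z = ω' (x : G ⧸ A) (y : G ⧸ A) (z : G ⧸ A)

end ThreeCocycle

/-- The conjugation action `g ▷ x = g x g⁻¹` of a group on itself. -/
def conjBy {G : Type u} [Group G] (g x : G) : G := g * x * g⁻¹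

namespace ThreeCocycle

variable {G : Type u} [Group G] (ω : ThreeCocycle G)

/-- `α_g(x,y) = ω(x,y,g) ω(x,y▷g,y)⁻¹ ω(xy▷g,x,y)`. -/
def alpha (g x y : G) : ℂˣ :=
  ω x y g * (ω x (conjBy y g) y)⁻¹ * ω (conjBy (x * y) g) x y

/-- `ψ(x,x',y,z) = ω(y,z,x')⁻¹ ω(y,x,z) α_x(z,z⁻¹)⁻¹`, the scalar contributed by the associativity
isomorphisms and the inverse braiding in one application of `σ₂⁻¹σ₁`. -/
def psi (x x' y z : G) : ℂˣ :=
  (ω y z x')⁻¹ * ω y x z * (ω.alpha x z z⁻¹)⁻¹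

/-- `Ω(x,y,z)`: the product of the factors `ψ` for the three applications of `σ₂⁻¹σ₁`. -/
def Omega (x y z : G) : ℂˣ :=
  ω.psi x (conjBy z⁻¹ x) (conjBy x y) z *
    ω.psi (conjBy x y) y (conjBy y z) (conjBy z⁻¹ x) *
      ω.psi (conjBy y z) z x y

end ThreeCocycle

/-- An object of `Vec_G^ω`: a finite-dimensional complex vector space with a `G`-grading. The
grading is given by the projections `proj x` onto the homogeneous components, a complete family of
orthogonal idempotents. (The cocycle only enters the associativity constraint.) -/
structure VecG {G : Type u} [Group G] [Fintype G] [DecidableEq G] (ω : ThreeCocycle G) where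
  carrier : Type
  [addCommGroup : AddCommGroup carrier]
  [module : Module ℂ carrier]
  [finiteDimensional : FiniteDimensional ℂ carrier]
  proj : G → carrier →ₗ[ℂ] carrier
  proj_proj : ∀ (x y : G) (v : carrier), proj x (proj y v) = if x = y then proj y v else 0
  sum_proj : ∀ v : carrier, ∑ x, proj x v = v

namespace VecG

variable {G : Type u} [Group G] [Fintype G] [DecidableEq G] {ω : ThreeCocycle G}

attribute [instance] addCommGroup module finiteDimensional

instance : CoeSort (VecG ω) Type := ⟨carrier⟩

/-- The homogeneous component `V_x`. -/
def component (V : VecG ω) (x : G) : Submodule ℂ V := LinearMap.range (V.proj x)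

/-- Morphisms of `Vec_G^ω` are the degree-preserving linear maps. -/
@[ext]
structure Hom (V W : VecG ω) where
  lin : V.carrier →ₗ[ℂ] W.carrier
  lin_proj : ∀ (x : G) (v : V.carrier), lin (V.proj x v) = W.proj x (lin v)

instance : Category (VecG ω) where
  Hom V W := Hom V W
  id V := ⟨LinearMap.id, fun _ _ => rfl⟩
  comp f g := ⟨g.lin ∘ₗ f.lin, fun x v => by simp [f.lin_proj, g.lin_proj]⟩

@[ext]
theorem hom_ext {V W : VecG ω} {f g : V ⟶ W} (h : Hom.lin f = Hom.lin g) : f = g := Hom.ext h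

@[simp]
theorem id_lin (V : VecG ω) : Hom.lin (𝟙 V) = LinearMap.id := rfl

@[simp]
theorem comp_lin {V W X : VecG ω} (f : V ⟶ W) (g : W ⟶ X) :
    Hom.lin (f ≫ g) = Hom.lin g ∘ₗ Hom.lin f := rfl

theorem proj_of_homog {V : VecG ω} {x : G} {v : V} (hv : V.proj x v = v) (y : G) :
    V.proj y v = if y = x then v else 0 := by
  rw [← hv, V.proj_proj, hv]

theorem hom_homog {V W : VecG ω} (f : Hom V W) {x : G} {v : V} (hv : V.proj x v = v) :
    W.proj x (f.lin v) = f.lin v := by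
  rw [← f.lin_proj, hv]

theorem ext_homog {V : VecG ω} {M : Type*} [AddCommGroup M] [Module ℂ M] {f g : V →ₗ[ℂ] M}
    (h : ∀ x v, V.proj x v = v → f v = g v) : f = g := by
  ext v
  rw [← V.sum_proj v, map_sum, map_sum]
  exact Finset.sum_congr rfl fun x _ => h x _ (by simp [V.proj_proj])

theorem ext_homog₂ {V W : VecG ω} {M : Type*} [AddCommGroup M] [Module ℂ M]
    {f g : V ⊗[ℂ] W →ₗ[ℂ] M}
    (h : ∀ x v y w, V.proj x v = v → W.proj y w = w → f (v ⊗ₜ w) = g (v ⊗ₜ w)) : f = g := by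
  apply TensorProduct.ext
  refine ext_homog fun x v hv => ?_
  refine ext_homog fun y w hw => ?_
  exact h x v y w hv hw

theorem ext_homog₃ {V W X : VecG ω} {M : Type*} [AddCommGroup M] [Module ℂ M]
    {f g : (V ⊗[ℂ] W) ⊗[ℂ] X →ₗ[ℂ] M}
    (h : ∀ x u y v z w, V.proj x u = u → W.proj y v = v → X.proj z w = w →
      f ((u ⊗ₜ v) ⊗ₜ w) = g ((u ⊗ₜ v) ⊗ₜ w)) : f = g := by
  apply TensorProduct.ext
  refine ext_homog₂ fun x u y v hu hv => ?_
  refine ext_homog fun z w hw => ?_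
  exact h x u y v z w hu hv hw

theorem ext_homog₃' {V W X : VecG ω} {M : Type*} [AddCommGroup M] [Module ℂ M]
    {f g : V ⊗[ℂ] (W ⊗[ℂ] X) →ₗ[ℂ] M}
    (h : ∀ x u y v z w, V.proj x u = u → W.proj y v = v → X.proj z w = w →
      f (u ⊗ₜ (v ⊗ₜ w)) = g (u ⊗ₜ (v ⊗ₜ w))) : f = g := by
  apply TensorProduct.ext
  refine ext_homog fun x u hu => ?_
  refine ext_homog₂ fun y v z w hv hw => ?_
  exact h x u y v z w hu hv hw

theorem ext_homog₄ {V W X Y : VecG ω} {M : Type*} [AddCommGroup M] [Module ℂ M]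
    {f g : ((V ⊗[ℂ] W) ⊗[ℂ] X) ⊗[ℂ] Y →ₗ[ℂ] M}
    (h : ∀ a t b u c v d w, V.proj a t = t → W.proj b u = u → X.proj c v = v → Y.proj d w = w →
      f (((t ⊗ₜ u) ⊗ₜ v) ⊗ₜ w) = g (((t ⊗ₜ u) ⊗ₜ v) ⊗ₜ w)) : f = g := by
  apply TensorProduct.ext
  refine ext_homog₃ fun a t b u c v ht hu hv => ?_
  refine ext_homog fun d w hw => ?_
  exact h a t b u c v d w ht hu hv hw

/-- The projection of `V ⊗ W` onto degree `g`: the sum of the projections onto `V_x ⊗ W_y` over all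
`x y = g`. -/
def tensorProj (V W : VecG ω) (g : G) : V ⊗[ℂ] W →ₗ[ℂ] V ⊗[ℂ] W :=
  ∑ x, TensorProduct.map (V.proj x) (W.proj (x⁻¹ * g))

theorem tensorProj_homog {V W : VecG ω} {x y : G} {v : V} {w : W} (hv : V.proj x v = v)
    (hw : W.proj y w = w) (g : G) :
    tensorProj V W g (v ⊗ₜ w) = if g = x * y then v ⊗ₜ w else 0 := by
  simp only [tensorProj, LinearMap.sum_apply, TensorProduct.map_tmul, proj_of_homog hv,
    proj_of_homog hw]
  rw [Finset.sum_eq_single x]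
  · by_cases h : g = x * y
    · simp [h]
    · have : x⁻¹ * g ≠ y := fun h' => h (by rw [← h']; simp)
      simp [h, this]
  · intro b _ hb
    simp [hb]
  · simp

/-- The tensor product of graded vector spaces, with `|v ⊗ w| = |v||w|`. -/
abbrev tensor (V W : VecG ω) : VecG ω where
  carrier := V ⊗[ℂ] W
  proj := tensorProj V W
  proj_proj a b v := by
    suffices h : tensorProj V W a ∘ₗ tensorProj V W b =
        if a = b then tensorProj V W b else 0 by
      have := LinearMap.congr_fun h v
      split_ifs at this ⊢ <;> simpa using this
    refine ext_homog₂ fun x v y w hv hw => ?_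
    simp only [LinearMap.comp_apply, tensorProj_homog hv hw]
    by_cases hb : b = x * y <;> by_cases hab : a = b <;>
      simp_all [tensorProj_homog hv hw]
  sum_proj v := by
    suffices h : ∑ x, tensorProj V W x = LinearMap.id by
      simpa using LinearMap.congr_fun h v
    refine ext_homog₂ fun x v y w hv hw => ?_
    simp [LinearMap.sum_apply, tensorProj_homog hv hw]

/-- The one-dimensional space `ℂ` placed in degree `g`. -/
abbrev line (ω : ThreeCocycle G) (g : G) : VecG ω where
  carrier := ℂ
  proj x := if x = g then LinearMap.id else 0
  proj_proj x y v := by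
    by_cases hy : y = g <;> by_cases hxy : x = y <;> simp_all
  sum_proj v := by
    rw [← LinearMap.sum_apply]
    simp

theorem line_homog (g : G) (c : ℂ) : (line ω g).proj g c = c := by
  change (if g = g then LinearMap.id else 0 : ℂ →ₗ[ℂ] ℂ) c = c
  simp

theorem eq_of_line_homog {g x : G} {c : ℂ} (hc : (line ω g).proj x c = c) : x = g ∨ c = 0 := by
  change (if x = g then LinearMap.id else 0 : ℂ →ₗ[ℂ] ℂ) c = c at hc
  by_cases h : x = g
  · exact Or.inl h
  · right
    simpa [h] using hc.symm

theorem tensor_homog {V W : VecG ω} {x y : G} {v : V} {w : W} (hv : V.proj x v = v)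
    (hw : W.proj y w = w) : (tensor V W).proj (x * y) (v ⊗ₜ[ℂ] w) = v ⊗ₜ[ℂ] w :=
  (tensorProj_homog hv hw _).trans (if_pos rfl)

/-- A linear map that sends homogeneous elements to homogeneous elements of the same degree. -/
def homOf {V W : VecG ω} (f : V.carrier →ₗ[ℂ] W.carrier)
    (hf : ∀ a, f ∘ₗ V.proj a = W.proj a ∘ₗ f) : V ⟶ W :=
  ⟨f, fun a v => LinearMap.congr_fun (hf a) v⟩

/-- The tensor product of morphisms. -/
def tensorMap {V V' W W' : VecG ω} (f : V ⟶ V') (g : W ⟶ W') : tensor V W ⟶ tensor V' W' :=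
  homOf (V := tensor V W) (W := tensor V' W') (TensorProduct.map (Hom.lin f) (Hom.lin g))
    fun a => by
      refine ext_homog₂ fun x v y w hv hw => ?_
      change TensorProduct.map _ _ (tensorProj V W a (v ⊗ₜ w)) = tensorProj V' W' a _
      rw [tensorProj_homog hv hw, TensorProduct.map_tmul,
        tensorProj_homog (hom_homog f hv) (hom_homog g hw)]
      split_ifs <;> simp

/-- The linear map `(u ⊗ v) ⊗ w ↦ ω(|u|,|v|,|w|) u ⊗ (v ⊗ w)`. -/
def assocLin (U V W : VecG ω) : (U ⊗[ℂ] V) ⊗[ℂ] W →ₗ[ℂ] U ⊗[ℂ] (V ⊗[ℂ] W) :=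
  ∑ x, ∑ y, ∑ z, (ω x y z : ℂ) •
    ((TensorProduct.assoc ℂ U V W).toLinearMap ∘ₗ
      TensorProduct.map (TensorProduct.map (U.proj x) (V.proj y)) (W.proj z))

/-- The linear map `u ⊗ (v ⊗ w) ↦ ω(|u|,|v|,|w|)⁻¹ (u ⊗ v) ⊗ w`. -/
def assocInvLin (U V W : VecG ω) : U ⊗[ℂ] (V ⊗[ℂ] W) →ₗ[ℂ] (U ⊗[ℂ] V) ⊗[ℂ] W :=
  ∑ x, ∑ y, ∑ z, ((ω x y z)⁻¹ : ℂ) •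
    ((TensorProduct.assoc ℂ U V W).symm.toLinearMap ∘ₗ
      TensorProduct.map (U.proj x) (TensorProduct.map (V.proj y) (W.proj z)))

section homog

variable {U V W : VecG ω} {x y z : G} {u : U} {v : V} {w : W}

theorem assocLin_homog (hu : U.proj x u = u) (hv : V.proj y v = v) (hw : W.proj z w = w) :
    assocLin U V W ((u ⊗ₜ v) ⊗ₜ w) = (ω x y z : ℂ) • (u ⊗ₜ (v ⊗ₜ w)) := by
  simp only [assocLin, LinearMap.sum_apply, LinearMap.smul_apply, LinearMap.comp_apply,
    TensorProduct.map_tmul, proj_of_homog hu, proj_of_homog hv, proj_of_homog hw]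
  rw [Finset.sum_eq_single x (by intro b _ hb; simp [hb]) (by simp),
    Finset.sum_eq_single y (by intro b _ hb; simp [hb]) (by simp),
    Finset.sum_eq_single z (by intro b _ hb; simp [hb]) (by simp)]
  simp

theorem assocInvLin_homog (hu : U.proj x u = u) (hv : V.proj y v = v) (hw : W.proj z w = w) :
    assocInvLin U V W (u ⊗ₜ (v ⊗ₜ w)) = ((ω x y z)⁻¹ : ℂ) • ((u ⊗ₜ v) ⊗ₜ w) := by
  simp only [assocInvLin, LinearMap.sum_apply, LinearMap.smul_apply, LinearMap.comp_apply,
    TensorProduct.map_tmul, proj_of_homog hu, proj_of_homog hv, proj_of_homog hw]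
  rw [Finset.sum_eq_single x (by intro b _ hb; simp [hb]) (by simp),
    Finset.sum_eq_single y (by intro b _ hb; simp [hb]) (by simp),
    Finset.sum_eq_single z (by intro b _ hb; simp [hb]) (by simp)]
  simp

end homog

/-- The associativity constraint `(u ⊗ v) ⊗ w ↦ ω(|u|,|v|,|w|) u ⊗ (v ⊗ w)` of `Vec_G^ω`. -/
def assocIso (U V W : VecG ω) : tensor (tensor U V) W ≅ tensor U (tensor V W) where
  hom := homOf (V := tensor (tensor U V) W) (W := tensor U (tensor V W)) (assocLin U V W)
    fun a => by
      refine ext_homog₃ fun x u y v z w hu hv hw => ?_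
      change assocLin U V W (tensorProj (tensor U V) W a ((u ⊗ₜ v) ⊗ₜ w)) =
        tensorProj U (tensor V W) a (assocLin U V W ((u ⊗ₜ v) ⊗ₜ w))
      rw [tensorProj_homog (tensor_homog hu hv) hw, assocLin_homog hu hv hw, map_smul,
        tensorProj_homog hu (tensor_homog hv hw), mul_assoc]
      split_ifs
      · exact assocLin_homog hu hv hw
      · simp
  inv := homOf (V := tensor U (tensor V W)) (W := tensor (tensor U V) W) (assocInvLin U V W)
    fun a => by
      refine ext_homog₃' fun x u y v z w hu hv hw => ?_
      change assocInvLin U V W (tensorProj U (tensor V W) a (u ⊗ₜ (v ⊗ₜ w))) =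
        tensorProj (tensor U V) W a (assocInvLin U V W (u ⊗ₜ (v ⊗ₜ w)))
      rw [tensorProj_homog hu (tensor_homog hv hw), assocInvLin_homog hu hv hw, map_smul,
        tensorProj_homog (tensor_homog hu hv) hw, mul_assoc]
      split_ifs
      · exact assocInvLin_homog hu hv hw
      · simp
  hom_inv_id := by
    apply hom_ext
    refine ext_homog₃ fun x u y v z w hu hv hw => ?_
    change assocInvLin U V W (assocLin U V W ((u ⊗ₜ v) ⊗ₜ w)) = (u ⊗ₜ v) ⊗ₜ w
    rw [assocLin_homog hu hv hw, map_smul, assocInvLin_homog hu hv hw, smul_smul]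
    simp
  inv_hom_id := by
    apply hom_ext
    refine ext_homog₃' fun x u y v z w hu hv hw => ?_
    change assocLin U V W (assocInvLin U V W (u ⊗ₜ (v ⊗ₜ w))) = u ⊗ₜ (v ⊗ₜ w)
    rw [assocInvLin_homog hu hv hw, map_smul, assocLin_homog hu hv hw, smul_smul]
    simp

/-- The left unit constraint `c ⊗ v ↦ c v`. -/
def leftUnitIso (V : VecG ω) : tensor (line ω 1) V ≅ V where
  hom := homOf (V := tensor (line ω 1) V) (W := V) (TensorProduct.lid ℂ V).toLinearMap
    fun a => by
      refine ext_homog₂ (V := line ω 1) fun x c y v hc hv => ?_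
      change TensorProduct.lid ℂ V (tensorProj (line ω 1) V a (c ⊗ₜ v)) =
        V.proj a (TensorProduct.lid ℂ V (c ⊗ₜ[ℂ] v))
      rw [tensorProj_homog (line_homog 1 c) hv, one_mul]
      have : V.proj a (TensorProduct.lid ℂ V (c ⊗ₜ[ℂ] v)) = c • V.proj a v := by
        rw [TensorProduct.lid_tmul, map_smul]
      rw [this, proj_of_homog hv]
      split_ifs
      · exact TensorProduct.lid_tmul v c
      · simp
  inv := homOf (V := V) (W := tensor (line ω 1) V) (TensorProduct.lid ℂ V).symm.toLinearMap
    fun a => by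
      refine ext_homog fun y v hv => ?_
      change (TensorProduct.lid ℂ V).symm (V.proj a v) =
        tensorProj (line ω 1) V a ((TensorProduct.lid ℂ V).symm v)
      rw [TensorProduct.lid_symm_apply, TensorProduct.lid_symm_apply,
        tensorProj_homog (line_homog 1 1) hv, one_mul, proj_of_homog hv]
      split_ifs <;> simp
  hom_inv_id := hom_ext (LinearMap.ext fun v => (TensorProduct.lid ℂ V).symm_apply_apply v)
  inv_hom_id := hom_ext (LinearMap.ext fun v => (TensorProduct.lid ℂ V).apply_symm_apply v)

/-- The right unit constraint `v ⊗ c ↦ c v`. -/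
def rightUnitIso (V : VecG ω) : tensor V (line ω 1) ≅ V where
  hom := homOf (V := tensor V (line ω 1)) (W := V) (TensorProduct.rid ℂ V).toLinearMap
    fun a => by
      refine ext_homog₂ (W := line ω 1) fun y v x c hv hc => ?_
      change TensorProduct.rid ℂ V (tensorProj V (line ω 1) a (v ⊗ₜ c)) =
        V.proj a (TensorProduct.rid ℂ V (v ⊗ₜ[ℂ] c))
      rw [tensorProj_homog hv (line_homog 1 c), mul_one]
      have : V.proj a (TensorProduct.rid ℂ V (v ⊗ₜ[ℂ] c)) = c • V.proj a v := by
        rw [TensorProduct.rid_tmul, map_smul]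
      rw [this, proj_of_homog hv]
      split_ifs
      · exact TensorProduct.rid_tmul v c
      · simp
  inv := homOf (V := V) (W := tensor V (line ω 1)) (TensorProduct.rid ℂ V).symm.toLinearMap
    fun a => by
      refine ext_homog fun y v hv => ?_
      change (TensorProduct.rid ℂ V).symm (V.proj a v) =
        tensorProj V (line ω 1) a ((TensorProduct.rid ℂ V).symm v)
      rw [TensorProduct.rid_symm_apply, TensorProduct.rid_symm_apply,
        tensorProj_homog hv (line_homog 1 1), mul_one, proj_of_homog hv]
      split_ifs <;> simp
  hom_inv_id := hom_ext (LinearMap.ext fun v => (TensorProduct.rid ℂ V).symm_apply_apply v)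
  inv_hom_id := hom_ext (LinearMap.ext fun v => (TensorProduct.rid ℂ V).apply_symm_apply v)

instance : MonoidalCategoryStruct (VecG ω) where
  tensorObj := tensor
  whiskerLeft V _ _ f := tensorMap (𝟙 V) f
  whiskerRight f V := tensorMap f (𝟙 V)
  tensorHom f g := tensorMap f g
  tensorUnit := line ω 1
  associator := assocIso
  leftUnitor := leftUnitIso
  rightUnitor := rightUnitIso

instance : MonoidalCategory (VecG ω) :=
  MonoidalCategory.ofTensorHom
    (id_tensorHom_id := fun V W => hom_ext TensorProduct.map_id)
    (id_tensorHom := fun _ _ _ _ => rfl)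
    (tensorHom_id := fun _ _ => rfl)
    (tensorHom_comp_tensorHom := fun f₁ f₂ g₁ g₂ =>
      hom_ext (TensorProduct.map_comp (Hom.lin g₁) (Hom.lin g₂) (Hom.lin f₁) (Hom.lin f₂)).symm)
    (associator_naturality := fun {X₁ X₂ X₃ Y₁ Y₂ Y₃} f₁ f₂ f₃ => by
      apply hom_ext
      refine ext_homog₃ fun x u y v z w hu hv hw => ?_
      change assocLin Y₁ Y₂ Y₃ ((Hom.lin f₁ u ⊗ₜ Hom.lin f₂ v) ⊗ₜ Hom.lin f₃ w) =
        TensorProduct.map (Hom.lin f₁) (TensorProduct.map (Hom.lin f₂) (Hom.lin f₃))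
          (assocLin X₁ X₂ X₃ ((u ⊗ₜ v) ⊗ₜ w))
      rw [assocLin_homog hu hv hw,
        assocLin_homog (hom_homog f₁ hu) (hom_homog f₂ hv) (hom_homog f₃ hw)]
      simp)
    (leftUnitor_naturality := fun {X Y} f => by
      apply hom_ext
      refine ext_homog₂ (V := line ω 1) fun x c y v _ _ => ?_
      change TensorProduct.lid ℂ Y (c ⊗ₜ[ℂ] Hom.lin f v) =
        Hom.lin f (TensorProduct.lid ℂ X (c ⊗ₜ[ℂ] v))
      exact (TensorProduct.lid_tmul (Hom.lin f v) c).trans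
        ((Hom.lin f).map_smul c v).symm)
    (rightUnitor_naturality := fun {X Y} f => by
      apply hom_ext
      refine ext_homog₂ (W := line ω 1) fun x v y c _ _ => ?_
      change TensorProduct.rid ℂ Y (Hom.lin f v ⊗ₜ[ℂ] c) =
        Hom.lin f (TensorProduct.rid ℂ X (v ⊗ₜ[ℂ] c))
      exact (TensorProduct.rid_tmul (Hom.lin f v) c).trans
        ((Hom.lin f).map_smul c v).symm)
    (pentagon := fun W X Y Z => by
      apply hom_ext
      refine ext_homog₄ fun a t b u c v d w ht hu hv hw => ?_
      change TensorProduct.map LinearMap.id (assocLin X Y Z)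
          (assocLin W (tensor X Y) Z
            (TensorProduct.map (assocLin W X Y) LinearMap.id (((t ⊗ₜ u) ⊗ₜ v) ⊗ₜ w))) =
        assocLin W X (tensor Y Z) (assocLin (tensor W X) Y Z (((t ⊗ₜ u) ⊗ₜ v) ⊗ₜ w))
      rw [TensorProduct.map_tmul, assocLin_homog ht hu hv,
        assocLin_homog (tensor_homog ht hu) hv hw, map_smul,
        assocLin_homog ht hu (tensor_homog hv hw)]
      rw [← TensorProduct.smul_tmul', map_smul, LinearMap.id_apply,
        assocLin_homog ht (tensor_homog hu hv) hw, smul_smul, map_smul, TensorProduct.map_tmul,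
        assocLin_homog hu hv hw, LinearMap.id_apply, TensorProduct.tmul_smul, smul_smul, smul_smul]
      congr 1
      have := congrArg (Units.val) (ω.cocycle a b c d)
      push_cast at this
      linear_combination this)
    (triangle := fun X Y => by
      apply hom_ext
      refine ext_homog₃ (W := line ω 1) fun x u y c z w hu _ hw => ?_
      change TensorProduct.map LinearMap.id (TensorProduct.lid ℂ Y).toLinearMap
          (assocLin X (line ω 1) Y ((u ⊗ₜ c) ⊗ₜ w)) =
        TensorProduct.map (TensorProduct.rid ℂ X).toLinearMap LinearMap.id ((u ⊗ₜ[ℂ] c) ⊗ₜ[ℂ] w)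
      rw [assocLin_homog hu (line_homog 1 c) hw, ω.one_mid, Units.val_one, one_smul,
        TensorProduct.map_tmul, TensorProduct.map_tmul]
      exact (TensorProduct.smul_tmul c u w).symm)

end VecG

namespace VecG

variable {G : Type u} [Group G] [Fintype G] [DecidableEq G] {ω : ThreeCocycle G}

instance : Limits.HasZeroMorphisms (VecG ω) where
  zero V W := ⟨⟨0, fun x v => by simp⟩⟩
  comp_zero f X := hom_ext (LinearMap.zero_comp (Hom.lin f))
  zero_comp X _ _ f := hom_ext (LinearMap.comp_zero (Hom.lin f))

@[simp]
theorem zero_lin (V W : VecG ω) : Hom.lin (0 : V ⟶ W) = 0 := rfl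

theorem whiskerLeft_zero' (U V W : VecG ω) : U ◁ (0 : V ⟶ W) = 0 :=
  hom_ext (TensorProduct.map_zero_right (LinearMap.id : U.carrier →ₗ[ℂ] U.carrier))

theorem zero_whiskerRight' (U V W : VecG ω) : (0 : V ⟶ W) ▷ U = 0 :=
  hom_ext (TensorProduct.map_zero_left (LinearMap.id : U.carrier →ₗ[ℂ] U.carrier))

theorem mem_component {V : VecG ω} {x : G} {v : V} : v ∈ V.component x ↔ V.proj x v = v := by
  constructor
  · rintro ⟨w, rfl⟩
    simp [V.proj_proj]
  · intro h
    exact ⟨v, h⟩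

theorem rid_tensorProj_line (V : VecG ω) (g b : G) (t : V ⊗[ℂ] ℂ) :
    TensorProduct.rid ℂ V (tensorProj V (line ω g) b t) =
      V.proj (b * g⁻¹) (TensorProduct.rid ℂ V t) := by
  suffices h : (TensorProduct.rid ℂ V).toLinearMap ∘ₗ tensorProj V (line ω g) b =
      V.proj (b * g⁻¹) ∘ₗ (TensorProduct.rid ℂ V).toLinearMap from LinearMap.congr_fun h t
  refine ext_homog₂ (W := line ω g) fun x v y c hv hc => ?_
  have e : ∀ u : V, TensorProduct.rid ℂ V (u ⊗ₜ[ℂ] (c : ℂ)) = (c : ℂ) • u :=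
    fun u => TensorProduct.rid_tmul u c
  change TensorProduct.rid ℂ V (tensorProj V (line ω g) b (v ⊗ₜ c)) =
    V.proj (b * g⁻¹) (TensorProduct.rid ℂ V (v ⊗ₜ[ℂ] (c : ℂ)))
  rw [tensorProj_homog hv (line_homog g c), e, map_smul, proj_of_homog hv]
  by_cases h : b = x * g
  · rw [if_pos h, if_pos (by rw [h]; group), e]
  · rw [if_neg h, if_neg (fun h' => h (by rw [← h']; group))]
    simp

end VecG

/-- The Drinfeld center of `Vec_G^ω`. Mathlib's objects are pairs of `W` with a half-braiding
`β_V : W ⊗ V ≅ V ⊗ W`; the half-braiding `σ_{V,W} : V ⊗ W ≅ W ⊗ V` of the right center is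
`β_V⁻¹`. -/
abbrev ZVecG {G : Type u} [Group G] [Fintype G] [DecidableEq G] (ω : ThreeCocycle G) :=
  Center (VecG ω)

namespace ZVecG

variable {G : Type u} [Group G] [Fintype G] [DecidableEq G] {ω : ThreeCocycle G}

instance : Limits.HasZeroMorphisms (ZVecG ω) where
  zero V W := ⟨⟨0, fun U => by
    rw [VecG.whiskerLeft_zero', VecG.zero_whiskerRight', Limits.zero_comp, Limits.comp_zero]⟩⟩
  comp_zero f X := Center.ext _ _ (Limits.comp_zero (f := f.f))
  zero_comp X _ _ f := Center.ext _ _ (Limits.zero_comp (f := f.f))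

/-- The braiding of the right center, `σ_{V,W}` being the half-braiding of `W` at `V`. -/
abbrev braiding (ω : ThreeCocycle G) : BraidedCategory (ZVecG ω) :=
  reverseBraiding (ZVecG ω)

/-- The half-braiding `σ_{V,W} : V ⊗ W ⟶ W ⊗ V` of an object `W` of the right center. -/
def halfBraiding (W : ZVecG ω) (V : VecG ω) : V ⊗ W.1 ⟶ W.1 ⊗ V := (W.2.β V).inv

/-- The (quasi-)action `g ▷ w` of `G` on an object `W` of the center, characterized by
`σ_{V,W}(v ⊗ w) = |v| ▷ w ⊗ v`: it is read off from `V = ℂ` in degree `g` and `v = 1`. -/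
def act (W : ZVecG ω) (g : G) : W.1.carrier →ₗ[ℂ] W.1.carrier :=
  (TensorProduct.rid ℂ W.1.carrier).toLinearMap ∘ₗ
    (VecG.Hom.lin (W.halfBraiding (VecG.line ω g)) :
      ℂ ⊗[ℂ] W.1.carrier →ₗ[ℂ] W.1.carrier ⊗[ℂ] ℂ) ∘ₗ
    TensorProduct.mk ℂ ℂ W.1.carrier 1

/-- `|g ▷ w| = g ▷ |w|`. -/
theorem act_mem (W : ZVecG ω) (g : G) {d : G} {w : W.1.carrier} (hw : w ∈ W.1.component d) :
    W.act g w ∈ W.1.component (conjBy g d) := by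
  rw [VecG.mem_component] at hw ⊢
  have h := VecG.hom_homog (W.halfBraiding (VecG.line ω g))
    (VecG.tensor_homog (VecG.line_homog (ω := ω) g 1) hw)
  have h2 := VecG.rid_tensorProj_line W.1 g (g * d)
    ((VecG.Hom.lin (W.halfBraiding (VecG.line ω g)) :
      ℂ ⊗[ℂ] W.1.carrier →ₗ[ℂ] W.1.carrier ⊗[ℂ] ℂ) ((1 : ℂ) ⊗ₜ[ℂ] w))
  exact h2.symm.trans (congrArg (TensorProduct.rid ℂ W.1.carrier) h)

/-- The action of `c ∈ C_G(g)` on the homogeneous component `W_g`. -/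
def actOn (W : ZVecG ω) (g : G) (c : Subgroup.centralizer ({g} : Set G)) :
    W.1.component g →ₗ[ℂ] W.1.component g :=
  (W.act (c : G)).restrict fun w hw => by
    have h := W.act_mem (c : G) hw
    have hc : conjBy (c : G) g = g := by
      have := Subgroup.mem_centralizer_singleton_iff.mp c.2
      rw [conjBy, this, mul_inv_cancel_right]
    rwa [hc] at h

/-- `W` is a simple object of the center with parameters `(g, χ)`: the degrees of its nonzero
homogeneous components form the conjugacy class of `g`, and `χ` is the (projective) character
of `C_G(g)` on `W_g`. -/
structure IsSimpleWith (W : ZVecG ω) (g : G) (χ : Subgroup.centralizer ({g} : Set G) → ℂ) :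
    Prop where
  simple : Simple W
  degrees : ∀ x : G, W.1.component x ≠ ⊥ ↔ IsConj g x
  char : ∀ c, χ c = LinearMap.trace ℂ _ (W.actOn g c)

/-- The (pivotal) trace of an endomorphism in the center of `Vec_G^ω`: for the canonical pivotal
structure it is the trace of the underlying linear map. -/
def ptr {W : ZVecG ω} (f : W ⟶ W) : ℂ := LinearMap.trace ℂ W.1.carrier (VecG.Hom.lin f.f)

end ZVecG

section Borromean

variable {C : Type*} [Category C] [MonoidalCategory C] [BraidedCategory C]

/-- The image of the braid `σ₂⁻¹σ₁` (first `σ₁`, then `σ₂⁻¹`) on three objects of a braided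
category. -/
def borromeanStep (X Y Z : C) : (X ⊗ Y) ⊗ Z ⟶ (Y ⊗ Z) ⊗ X :=
  (β_ X Y).hom ▷ Z ≫ (α_ Y X Z).hom ≫ Y ◁ (β_ Z X).inv ≫ (α_ Y Z X).inv

/-- The image of the Borromean braid `(σ₂⁻¹σ₁)³`. -/
def borromeanBraid (X Y Z : C) : (X ⊗ Y) ⊗ Z ⟶ (X ⊗ Y) ⊗ Z :=
  borromeanStep X Y Z ≫ borromeanStep Y Z X ≫ borromeanStep Z X Y

end Borromean

/-- The Borromean tensor `B_{U,V,W}` of the center of `Vec_G^ω`. -/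
def borromeanTensor {G : Type u} [Group G] [Fintype G] [DecidableEq G] {ω : ThreeCocycle G}
    (U V W : ZVecG ω) : ℂ :=
  ZVecG.ptr (@borromeanBraid (ZVecG ω) _ _ (ZVecG.braiding ω) U V W)

end

/-!
The underlying linear maps of the half-braidings are governed by the quasi-action `g ▷ ·`:
naturality along the morphism `ℂ_x → V`, `1 ↦ v`, gives `σ_{V,W}(v ⊗ w) = |v| ▷ w ⊗ v`
(`ZVecG.halfBraidingLin_tmul`), and compatibility with the tensor product gives
`xy ▷ w = α_d(x, y) x ▷ (y ▷ w)` for `w` of degree `d` (`ZVecG.act_act`).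

A normalized cocycle inflated from `G ⧸ A` takes the value `1` as soon as one argument lies in `A`.
All degrees of `U` and `V` lie in `A`, so `G` acts linearly on both of them (`ZVecG.actRep`), and
every associator met by the Borromean braid is trivial. Write `a, b ∈ A` and `c` for the degrees of
`u`, `v` and `w`. Since `a` and `b` commute, the braid sends `(u ⊗ v) ⊗ w` to
`([b, c] ▷ u ⊗ [c⁻¹, a⁻¹] ▷ v) ⊗ w` (`ZVecG.borromean_tmul`). The commutators lie in `A`, so degrees
are preserved, and the trace is the sum over all `a`, `b`, `c` of the product of the traces on
`U_a`, `V_b` and the dimension of `W_c` (`ZVecG.borromeanTensor_eq_sum`).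

Simultaneous conjugation shows that all `c` conjugate to `k` contribute equally
(`ZVecG.sum_compTrace_conjBy`, `ZVecG.compTrace_one_conjBy`), which produces the factor
`|k̄| χ₃(1)`. Conjugating by `p` and `q` moves the remaining traces to `U_g` and `V_h`, where they
are values of `χ₁` and `χ₂`.
-/

/-! ### Half-braidings and the quasi-action -/

namespace VecG

variable {G : Type*} [Group G] [Fintype G] [DecidableEq G] {ω : ThreeCocycle G}

/-- A homogeneous element of degree `x`, as a morphism from the line of degree `x`. -/
noncomputable def homOfHomog {V : VecG ω} {x : G} {v : V} (hv : V.proj x v = v) : line ω x ⟶ V :=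
  homOf (V := line ω x) (W := V) (LinearMap.toSpanSingleton ℂ V.carrier v) fun a => by
    apply LinearMap.ext_ring
    change LinearMap.toSpanSingleton ℂ V.carrier v
      ((if a = x then LinearMap.id else 0 : ℂ →ₗ[ℂ] ℂ) 1) =
        V.proj a (LinearMap.toSpanSingleton ℂ V.carrier v 1)
    rw [LinearMap.toSpanSingleton_apply_one, proj_of_homog hv]
    split_ifs <;> simp

end VecG

namespace ZVecG

variable {G : Type*} [Group G] [Fintype G] [DecidableEq G] {ω : ThreeCocycle G}

/-- The linear map underlying the inverse `W ⊗ V → V ⊗ W` of the half-braiding `σ_{V,W}`. -/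
noncomputable def halfBraidingInvLin (W : ZVecG ω) (V : VecG ω) :
    W.1.carrier ⊗[ℂ] V.carrier →ₗ[ℂ] V.carrier ⊗[ℂ] W.1.carrier :=
  VecG.Hom.lin (W.2.β V).hom

/-- The linear map underlying the half-braiding `σ_{V,W}`. -/
noncomputable def halfBraidingLin (W : ZVecG ω) (V : VecG ω) :
    V.carrier ⊗[ℂ] W.1.carrier →ₗ[ℂ] W.1.carrier ⊗[ℂ] V.carrier :=
  VecG.Hom.lin (W.halfBraiding V)

theorem halfBraidingInvLin_apply (W : ZVecG ω) (V : VecG ω)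
    (t : V.carrier ⊗[ℂ] W.1.carrier) :
    W.halfBraidingInvLin V (W.halfBraidingLin V t) = t :=
  LinearMap.congr_fun (congrArg VecG.Hom.lin (W.2.β V).inv_hom_id) t

theorem halfBraidingLin_apply (W : ZVecG ω) (V : VecG ω)
    (t : W.1.carrier ⊗[ℂ] V.carrier) :
    W.halfBraidingLin V (W.halfBraidingInvLin V t) = t :=
  LinearMap.congr_fun (congrArg VecG.Hom.lin (W.2.β V).hom_inv_id) t

/-- The half-braiding is determined by the action: naturality along the morphism from a line that
picks out the homogeneous element `v` reduces it to the case of a line. -/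
theorem halfBraidingLin_tmul (W : ZVecG ω) {V : VecG ω} {x : G} {v : V} (hv : V.proj x v = v)
    (w : W.1.carrier) : W.halfBraidingLin V (v ⊗ₜ w) = W.act x w ⊗ₜ v := by
  have nat : VecG.homOfHomog hv ▷ W.1 ≫ W.halfBraiding V =
      W.halfBraiding (VecG.line ω x) ≫ W.1 ◁ VecG.homOfHomog hv := by
    unfold halfBraiding
    rw [Iso.comp_inv_eq, Category.assoc, Iso.eq_inv_comp]
    exact (W.2.naturality (VecG.homOfHomog hv)).symm
  have e := LinearMap.congr_fun (congrArg VecG.Hom.lin nat) ((1 : ℂ) ⊗ₜ[ℂ] w)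
  have e' : W.halfBraidingLin V ((LinearMap.toSpanSingleton ℂ V.carrier v 1) ⊗ₜ w) =
      TensorProduct.map LinearMap.id (LinearMap.toSpanSingleton ℂ V.carrier v)
        (W.halfBraidingLin (VecG.line ω x) ((1 : ℂ) ⊗ₜ[ℂ] w)) := e
  rw [LinearMap.toSpanSingleton_apply_one] at e'
  rw [e']
  have h : (W.act x w) ⊗ₜ[ℂ] (1 : ℂ) = W.halfBraidingLin (VecG.line ω x) ((1 : ℂ) ⊗ₜ[ℂ] w) :=
    (TensorProduct.rid ℂ W.1.carrier).symm_apply_apply _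
  have h2 : TensorProduct.map LinearMap.id (LinearMap.toSpanSingleton ℂ V.carrier v)
      ((W.act x w) ⊗ₜ[ℂ] (1 : ℂ)) = W.act x w ⊗ₜ v := by simp
  rw [← h2]
  exact congrArg _ h.symm

theorem halfBraidingInvLin_tmul (W : ZVecG ω) {V : VecG ω} {x : G} {v : V} (hv : V.proj x v = v)
    (w : W.1.carrier) : W.halfBraidingInvLin V (W.act x w ⊗ₜ v) = v ⊗ₜ w := by
  rw [← W.halfBraidingLin_tmul hv, halfBraidingInvLin_apply]

theorem act_injective (W : ZVecG ω) (x : G) : Function.Injective (W.act x) := fun w w' h => by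
  have h1 := W.halfBraidingInvLin_tmul (VecG.line_homog (ω := ω) x 1) w
  rw [h, W.halfBraidingInvLin_tmul (VecG.line_homog (ω := ω) x 1)] at h1
  simpa using congrArg (TensorProduct.lid ℂ W.1.carrier) h1.symm

/-- The quasi-action property `x ▷ (y ▷ w) = α_d(x, y)⁻¹ (xy ▷ w)` for `w` of degree `d`. -/
theorem act_act (W : ZVecG ω) (x y : G) {d : G} {w : W.1.carrier} (hw : W.1.proj d w = w) :
    W.act x (W.act y w) = ((ω.alpha d x y)⁻¹ : ℂˣ) • W.act (x * y) w := by
  have hy := VecG.mem_component.1 (W.act_mem y (VecG.mem_component.2 hw))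
  have hxy := VecG.mem_component.1 (W.act_mem x (VecG.mem_component.2 hy))
  have h1x := VecG.line_homog (ω := ω) x 1
  have h1y := VecG.line_homog (ω := ω) y 1
  have hom : W.halfBraidingInvLin (VecG.tensor (VecG.line ω x) (VecG.line ω y))
      (W.act x (W.act y w) ⊗ₜ[ℂ] ((1 : ℂ) ⊗ₜ[ℂ] (1 : ℂ))) =
      VecG.assocInvLin (VecG.line ω x) (VecG.line ω y) W.1
        (TensorProduct.map LinearMap.id (W.halfBraidingInvLin (VecG.line ω y))
          (VecG.assocLin (VecG.line ω x) W.1 (VecG.line ω y)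
            (TensorProduct.map (W.halfBraidingInvLin (VecG.line ω x)) LinearMap.id
              (VecG.assocInvLin W.1 (VecG.line ω x) (VecG.line ω y)
                (W.act x (W.act y w) ⊗ₜ[ℂ] ((1 : ℂ) ⊗ₜ[ℂ] (1 : ℂ))))))) :=
    LinearMap.congr_fun (congrArg VecG.Hom.lin
      (W.2.monoidal (VecG.line ω x) (VecG.line ω y))) _
  rw [VecG.assocInvLin_homog hxy h1x h1y, map_smul, TensorProduct.map_tmul,
    W.halfBraidingInvLin_tmul h1x, map_smul, LinearMap.id_apply, VecG.assocLin_homog h1x hy h1y,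
    smul_smul, map_smul, TensorProduct.map_tmul, W.halfBraidingInvLin_tmul h1y, map_smul,
    LinearMap.id_apply, VecG.assocInvLin_homog h1x h1y hw, smul_smul] at hom
  have hom' := congrArg (W.halfBraidingLin (VecG.tensor (VecG.line ω x) (VecG.line ω y))) hom
  rw [halfBraidingLin_apply, map_smul,
    W.halfBraidingLin_tmul (V := VecG.tensor (VecG.line ω x) (VecG.line ω y))
      (VecG.tensor_homog h1x h1y)] at hom'
  -- Strip the tensor factor `1 ⊗ 1` from both sides.
  have e := congrArg ((TensorProduct.rid ℂ W.1.carrier).toLinearMap ∘ₗ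
    TensorProduct.map LinearMap.id (TensorProduct.lid ℂ ℂ).toLinearMap) hom'
  simp only [map_smul, LinearMap.comp_apply, TensorProduct.map_tmul, LinearMap.id_apply,
    LinearEquiv.coe_coe, TensorProduct.lid_tmul, TensorProduct.rid_tmul, smul_eq_mul, mul_one,
    one_smul] at e
  have hc : conjBy x (conjBy y d) = conjBy (x * y) d := by simp only [conjBy]; group
  rw [e, Units.smul_def, ThreeCocycle.alpha, hc]
  congr 1
  simp only [mul_inv, inv_inv, Units.val_mul, Units.val_inv_eq_inv_val]
  ring

/-- `1 ▷ ·` is idempotent, because `α_d(1, 1) = 1`, and injective. -/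
theorem act_one (W : ZVecG ω) : W.act 1 = LinearMap.id := by
  refine VecG.ext_homog fun d w hw => W.act_injective 1 ?_
  have h := W.act_act 1 1 hw
  have hα : ω.alpha d 1 1 = 1 := by simp [ThreeCocycle.alpha, ω.one_left, ω.one_mid]
  rw [h, hα]
  simp

/-! ### The Borromean braid on linear maps -/

/-- The linear map underlying the braid `σ₂⁻¹σ₁` on `(X ⊗ Y) ⊗ Z`: the braiding `X ⊗ Y → Y ⊗ X` is
the half-braiding of `Y` at `X`, the inverse braiding `X ⊗ Z → Z ⊗ X` is the inverse half-braiding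
of `X` at `Z`. -/
noncomputable def borromeanStepLin (X Y Z : ZVecG ω) :
    (X.1.carrier ⊗[ℂ] Y.1.carrier) ⊗[ℂ] Z.1.carrier →ₗ[ℂ]
      (Y.1.carrier ⊗[ℂ] Z.1.carrier) ⊗[ℂ] X.1.carrier :=
  VecG.assocInvLin Y.1 Z.1 X.1 ∘ₗ
    TensorProduct.map LinearMap.id (X.halfBraidingInvLin Z.1) ∘ₗ
      VecG.assocLin Y.1 X.1 Z.1 ∘ₗ TensorProduct.map (Y.halfBraidingLin X.1) LinearMap.id

theorem borromeanStep_lin (X Y Z : ZVecG ω) :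
    VecG.Hom.lin (@borromeanStep (ZVecG ω) _ _ (ZVecG.braiding ω) X Y Z).f =
      borromeanStepLin X Y Z := by
  have h1 : (Center.braiding Y X).inv.f = Y.halfBraiding X.1 := by
    change inv (Y.2.β X.1).hom = (Y.2.β X.1).inv
    simp
  have h : (@borromeanStep (ZVecG ω) _ _ (ZVecG.braiding ω) X Y Z).f =
      Y.halfBraiding X.1 ▷ Z.1 ≫ (α_ Y.1 X.1 Z.1).hom ≫ Y.1 ◁ (X.2.β Z.1).hom ≫
        (α_ Y.1 Z.1 X.1).inv := by
    rw [← Center.associator_inv_f, ← h1]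
    rfl
  rw [h]
  rfl

theorem borromeanTensor_eq_trace (X Y Z : ZVecG ω) :
    borromeanTensor X Y Z = LinearMap.trace ℂ _
      (borromeanStepLin Z X Y ∘ₗ borromeanStepLin Y Z X ∘ₗ borromeanStepLin X Y Z) := by
  rw [← borromeanStep_lin, ← borromeanStep_lin, ← borromeanStep_lin]
  rfl

/-- One step `σ₂⁻¹σ₁` on homogeneous elements. The vector `u'` with `c ▷ u' = u` stands for the
image of `u` under the inverse of `c ▷ ·`; it is passed as an argument because that inverse differs
from `c⁻¹ ▷ ·` by a scalar when the action is only projective. -/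
theorem borromeanStepLin_tmul (X Y Z : ZVecG ω) {a a' b c : G} {u u' : X.1.carrier}
    {v : Y.1.carrier} {w : Z.1.carrier} (hu : X.1.proj a u = u) (hv : Y.1.proj b v = v)
    (hw : Z.1.proj c w = w) (hu' : X.1.proj a' u' = u') (h : X.act c u' = u) :
    borromeanStepLin X Y Z ((u ⊗ₜ v) ⊗ₜ w) =
      (ω (conjBy a b) a c * (ω (conjBy a b) c a')⁻¹ : ℂˣ) • ((Y.act a v ⊗ₜ w) ⊗ₜ u') := by
  have hav := VecG.mem_component.1 (Y.act_mem a (VecG.mem_component.2 hv))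
  simp only [borromeanStepLin, LinearMap.comp_apply]
  rw [TensorProduct.map_tmul, Y.halfBraidingLin_tmul hu, LinearMap.id_apply,
    VecG.assocLin_homog hav hu hw, map_smul, TensorProduct.map_tmul, ← h,
    X.halfBraidingInvLin_tmul hw, LinearMap.id_apply, map_smul, VecG.assocInvLin_homog hav hw hu',
    smul_smul, Units.smul_def]
  simp

end ZVecG

/-! ### Conjugation in a group with a normal subgroup -/

section Conjugation

variable {G : Type*} [Group G]

theorem conjBy_inv_conjBy (x d : G) : conjBy x⁻¹ (conjBy x d) = d := by
  simp only [conjBy]; group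

theorem conjBy_conjBy_inv (x d : G) : conjBy x (conjBy x⁻¹ d) = d := by
  simp only [conjBy]; group

theorem conjBy_mem {A : Subgroup G} [hA : A.Normal] (x : G) {d : G} (hd : d ∈ A) :
    conjBy x d ∈ A := hA.conj_mem d hd x

theorem commutator_mem_left {A : Subgroup G} [hA : A.Normal] {x : G} (hx : x ∈ A) (y : G) :
    ⁅x, y⁆ ∈ A := by
  rw [commutatorElement_def, mul_assoc, mul_assoc, ← mul_assoc y]
  exact A.mul_mem hx (hA.conj_mem _ (A.inv_mem hx) y)

theorem commutator_mem_right {A : Subgroup G} [hA : A.Normal] (x : G) {y : G} (hy : y ∈ A) :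
    ⁅x, y⁆ ∈ A :=
  A.mul_mem (hA.conj_mem _ hy x) (A.inv_mem hy)

theorem mem_of_isConj {A : Subgroup G} [hA : A.Normal] {g x : G} (hg : g ∈ A) (h : IsConj g x) :
    x ∈ A := by
  obtain ⟨c, rfl⟩ := isConj_iff.1 h
  exact hA.conj_mem g hg c

end Conjugation

/-! ### Inflated cocycles -/

namespace ThreeCocycle.IsInflatedFrom

variable {G : Type*} [Group G] {ω : ThreeCocycle G} {A : Subgroup G} [A.Normal]

theorem apply_left (hω : ω.IsInflatedFrom A) {a : G} (ha : a ∈ A) (y z : G) : ω a y z = 1 := by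
  obtain ⟨ω', h⟩ := hω
  rw [h, (QuotientGroup.eq_one_iff a).2 ha, ω'.one_left]

theorem apply_mid (hω : ω.IsInflatedFrom A) {a : G} (ha : a ∈ A) (x z : G) : ω x a z = 1 := by
  obtain ⟨ω', h⟩ := hω
  rw [h, (QuotientGroup.eq_one_iff a).2 ha, ω'.one_mid]

theorem apply_right (hω : ω.IsInflatedFrom A) {a : G} (ha : a ∈ A) (x y : G) : ω x y a = 1 := by
  obtain ⟨ω', h⟩ := hω
  rw [h, (QuotientGroup.eq_one_iff a).2 ha, ω'.one_right]

theorem alpha_of_mem (hω : ω.IsInflatedFrom A) {a : G} (ha : a ∈ A) (x y : G) :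
    ω.alpha a x y = 1 := by
  simp [alpha, hω.apply_left (conjBy_mem _ ha), hω.apply_mid (conjBy_mem _ ha), hω.apply_right ha]

theorem alpha_of_mem_left (hω : ω.IsInflatedFrom A) {a : G} (ha : a ∈ A) (d y : G) :
    ω.alpha d a y = 1 := by
  simp [alpha, hω.apply_left ha, hω.apply_mid ha]

theorem Omega_eq_one (hω : ω.IsInflatedFrom A) {x y : G} (hx : x ∈ A) (hy : y ∈ A) (k : G) :
    ω.Omega x y k = 1 := by
  simp [Omega, psi, hω.alpha_of_mem hx, hω.alpha_of_mem_left (conjBy_mem k⁻¹ hx),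
    hω.alpha_of_mem_left hy, hω.apply_left hx, hω.apply_mid hx, hω.apply_right hy,
    hω.apply_right (conjBy_mem k⁻¹ hx)]

end ThreeCocycle.IsInflatedFrom

/-! ### Traces on homogeneous components -/

namespace ZVecG

variable {G : Type*} [Group G] [Fintype G] [DecidableEq G] {ω : ThreeCocycle G}

/-- `s ▷ ·` carries the component of degree `d` to the one of degree `s ▷ d`. -/
theorem act_comp_proj (W : ZVecG ω) (s d : G) :
    W.act s ∘ₗ W.1.proj d = W.1.proj (conjBy s d) ∘ₗ W.act s := by
  refine VecG.ext_homog fun e w hw => ?_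
  have h := VecG.mem_component.1 (W.act_mem s (VecG.mem_component.2 hw))
  rw [LinearMap.comp_apply, LinearMap.comp_apply, VecG.proj_of_homog hw, VecG.proj_of_homog h]
  by_cases hde : d = e
  · simp [hde]
  · have : conjBy s d ≠ conjBy s e := fun h' => hde (by
      rw [← conjBy_inv_conjBy s d, h', conjBy_inv_conjBy])
    simp [hde, this]

/-- The trace of the projection onto the component `W_d` followed by `s ▷ ·`. For `s ∈ C_G(d)` it is
the value of the character of `W_d` at `s`. -/
noncomputable def compTrace (W : ZVecG ω) (s d : G) : ℂ :=
  LinearMap.trace ℂ W.1.carrier (W.act s ∘ₗ W.1.proj d)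

theorem compTrace_eq_trace_actOn (W : ZVecG ω) (d : G)
    (c : Subgroup.centralizer ({d} : Set G)) :
    W.compTrace c d = LinearMap.trace ℂ _ (W.actOn d c) := by
  let r : W.1.carrier →ₗ[ℂ] W.1.component d :=
    (W.1.proj d).codRestrict (W.1.component d) fun w => ⟨w, rfl⟩
  have h : W.act (c : G) ∘ₗ W.1.proj d = (W.1.component d).subtype ∘ₗ W.actOn d c ∘ₗ r := by
    ext w; rfl
  have h' : (W.actOn d c ∘ₗ r) ∘ₗ (W.1.component d).subtype = W.actOn d c := by
    ext w
    exact congrArg (W.act (c : G)) (VecG.mem_component.1 w.2)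
  rw [compTrace, h, LinearMap.trace_comp_comm', h']

theorem compTrace_of_proj_eq_zero (W : ZVecG ω) {d : G} (h : W.1.proj d = 0) (s : G) :
    W.compTrace s d = 0 := by
  simp [compTrace, h]

/-- The components of conjugate degrees have equal dimension. -/
theorem compTrace_one_conjBy (W : ZVecG ω) (s d : G) :
    W.compTrace 1 (conjBy s d) = W.compTrace 1 d := by
  let e := LinearEquiv.ofInjectiveEndo (W.act s) (W.act_injective s)
  have he : W.1.proj (conjBy s d) = e.conj (W.1.proj d) := by
    rw [LinearEquiv.conj_apply]
    have h : e.toLinearMap ∘ₗ W.1.proj d = W.1.proj (conjBy s d) ∘ₗ e.toLinearMap :=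
      W.act_comp_proj s d
    rw [h, LinearMap.comp_assoc]
    simp
  rw [compTrace, compTrace, act_one, LinearMap.id_comp, LinearMap.id_comp, he,
    LinearMap.trace_conj']

theorem IsSimpleWith.proj_eq_zero {W : ZVecG ω} {g : G}
    {χ : Subgroup.centralizer ({g} : Set G) → ℂ} (hW : W.IsSimpleWith g χ) {d : G}
    (hd : ¬ IsConj g d) : W.1.proj d = 0 :=
  LinearMap.range_eq_bot.1 (not_not.1 (mt (hW.degrees d).1 hd))

theorem IsSimpleWith.compTrace_eq {W : ZVecG ω} {g : G}
    {χ : Subgroup.centralizer ({g} : Set G) → ℂ} (hW : W.IsSimpleWith g χ)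
    (c : Subgroup.centralizer ({g} : Set G)) : W.compTrace c g = χ c := by
  rw [compTrace_eq_trace_actOn, hW.char]

/-! ### The action for an inflated cocycle -/

section Inflated

variable {A : Subgroup G} [A.Normal]

/-- If `ω` is inflated from `G ⧸ A` and all degrees of `W` lie in `A`, then the action of `G` on
`W` is a linear representation. -/
noncomputable def actRep (hω : ω.IsInflatedFrom A) (W : ZVecG ω)
    (hW : ∀ d ∉ A, W.1.proj d = 0) : Representation ℂ G W.1.carrier where
  toFun := W.act
  map_one' := W.act_one
  map_mul' x y := by
    refine VecG.ext_homog fun d w hw => ?_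
    by_cases hd : d ∈ A
    · have h := W.act_act x y hw
      rw [hω.alpha_of_mem hd, inv_one, one_smul] at h
      exact h.symm
    · rw [← hw, hW d hd]
      simp

theorem act_mul (hω : ω.IsInflatedFrom A) (W : ZVecG ω) (hW : ∀ d ∉ A, W.1.proj d = 0)
    (x y : G) : W.act (x * y) = W.act x ∘ₗ W.act y := map_mul (actRep hω W hW) x y

/-- For a linear action, conjugation by `s ▷ ·` identifies the trace of `r` on `W_d` with the trace
of `s ▷ r` on the component of degree `s ▷ d`. -/
theorem compTrace_conjBy (hω : ω.IsInflatedFrom A) (W : ZVecG ω)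
    (hW : ∀ d ∉ A, W.1.proj d = 0) (s r d : G) :
    W.compTrace (conjBy s r) (conjBy s d) = W.compTrace r d := by
  have h : W.act (conjBy s r) ∘ₗ W.1.proj (conjBy s d) =
      W.act s ∘ₗ (W.act r ∘ₗ W.1.proj d) ∘ₗ W.act s⁻¹ := by
    have h1 := W.act_comp_proj s⁻¹ (conjBy s d)
    rw [conjBy_inv_conjBy] at h1
    rw [LinearMap.comp_assoc, ← h1, conjBy, act_mul hω W hW, act_mul hω W hW]
    rfl
  have h2 : W.act s⁻¹ ∘ₗ W.act s = LinearMap.id := by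
    rw [← act_mul hω W hW, inv_mul_cancel, act_one]
  rw [compTrace, h, LinearMap.trace_comp_comm', LinearMap.comp_assoc, h2]
  rfl

/-- The action of `C_G(g)` on the component of degree `g` as a representation. -/
theorem exists_representation (hω : ω.IsInflatedFrom A) (W : ZVecG ω)
    (hW : ∀ d ∉ A, W.1.proj d = 0) (g : G) :
    ∃ ρ : Representation ℂ (Subgroup.centralizer ({g} : Set G)) (W.1.component g),
      ∀ c, ρ c = W.actOn g c := by
  refine ⟨⟨⟨W.actOn g, ?_⟩, fun x y => ?_⟩, fun _ => rfl⟩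
  · ext w
    exact LinearMap.congr_fun W.act_one w.1
  · ext w
    exact LinearMap.congr_fun (act_mul hω W hW x y) w.1

end Inflated

end ZVecG

/-! ### The trace of the Borromean braid -/

theorem sum_eq_sum_conjugatesOf {G M : Type*} [Group G] [Fintype G] [DecidableEq G]
    [AddCommMonoid M] (d : G) {f : G → M} (hf : ∀ a, ¬ IsConj d a → f a = 0) :
    ∑ a, f a = ∑ a : conjugatesOf d, f a := by
  rw [← Finset.sum_filter_of_ne fun a _ ha => not_not.1 (mt (hf a) ha)]
  exact Finset.sum_subtype _ (fun a => Finset.mem_filter_univ a) f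

namespace ZVecG

variable {G : Type*} [Group G] [Fintype G] [DecidableEq G] {ω : ThreeCocycle G}
  {A : Subgroup G} [A.Normal]

/-- The Borromean braid on homogeneous elements of degrees `a, b ∈ A` and `c`. It acts diagonally:
the third step applies the inverse of `b ▷ ·` to the vector `b ▷ w` produced by the second, so that
the possibly projective action on `W` cancels exactly. -/
theorem borromean_tmul (hA : ∀ a ∈ A, ∀ b ∈ A, a * b = b * a) (hω : ω.IsInflatedFrom A)
    (U V W : ZVecG ω) (hU : ∀ d ∉ A, U.1.proj d = 0) (hV : ∀ d ∉ A, V.1.proj d = 0)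
    {a b c : G} (ha : a ∈ A) (hb : b ∈ A) {u : U.1.carrier} {v : V.1.carrier} {w : W.1.carrier}
    (hu : U.1.proj a u = u) (hv : V.1.proj b v = v) (hw : W.1.proj c w = w) :
    borromeanStepLin W U V (borromeanStepLin V W U (borromeanStepLin U V W ((u ⊗ₜ v) ⊗ₜ w))) =
      (U.act ⁅b, c⁆ u ⊗ₜ V.act ⁅c⁻¹, a⁻¹⁆ v) ⊗ₜ w := by
  have hconj : ∀ {x y : G}, x ∈ A → y ∈ A → conjBy x y = y := fun hx hy => by
    rw [conjBy, hA _ hx _ hy, mul_inv_cancel_right]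
  have ha' : conjBy c⁻¹ a ∈ A := conjBy_mem c⁻¹ ha
  have hu' := VecG.mem_component.1 (U.act_mem c⁻¹ (VecG.mem_component.2 hu))
  have hcu : U.act c (U.act c⁻¹ u) = u := by
    rw [← LinearMap.comp_apply, ← act_mul hω U hU, mul_inv_cancel, act_one, LinearMap.id_apply]
  have hav := VecG.mem_component.1 (V.act_mem a (VecG.mem_component.2 hv))
  rw [hconj ha hb] at hav
  have hv' := VecG.mem_component.1
    (V.act_mem (conjBy c⁻¹ a)⁻¹ (VecG.mem_component.2 hav))
  rw [hconj (A.inv_mem ha') hb] at hv'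
  have hav' : V.act (conjBy c⁻¹ a) (V.act (conjBy c⁻¹ a)⁻¹ (V.act a v)) = V.act a v := by
    rw [← LinearMap.comp_apply, ← act_mul hω V hV, mul_inv_cancel, act_one, LinearMap.id_apply]
  have hbw := VecG.mem_component.1 (W.act_mem b (VecG.mem_component.2 hw))
  -- Each associativity scalar has an argument in `A`, hence equals `1`.
  rw [borromeanStepLin_tmul U V W hu hv hw hu' hcu, hω.apply_mid ha, hω.apply_right ha', inv_one,
    mul_one, one_smul, borromeanStepLin_tmul V W U hav hw hu' hv' hav', hω.apply_mid hb,
    hω.apply_right hb, inv_one, mul_one, one_smul,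
    borromeanStepLin_tmul W U V hbw hu' hv' hw rfl, hω.apply_right hb, hω.apply_mid hb, inv_one,
    mul_one, one_smul, ← LinearMap.comp_apply, ← act_mul hω U hU, ← LinearMap.comp_apply,
    ← act_mul hω V hV]
  congr 4
  simp only [conjBy, commutatorElement_def]; group

/-- The trace of the Borromean braid, before collecting the degrees into conjugacy classes. -/
theorem borromeanTensor_eq_sum (hA : ∀ a ∈ A, ∀ b ∈ A, a * b = b * a) (hω : ω.IsInflatedFrom A)
    (U V W : ZVecG ω) (hU : ∀ d ∉ A, U.1.proj d = 0) (hV : ∀ d ∉ A, V.1.proj d = 0) :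
    borromeanTensor U V W = ∑ c, W.compTrace 1 c *
      ∑ a, ∑ b, U.compTrace ⁅b, c⁆ a * V.compTrace ⁅c⁻¹, a⁻¹⁆ b := by
  have h : borromeanStepLin W U V ∘ₗ borromeanStepLin V W U ∘ₗ borromeanStepLin U V W =
      ∑ c, ∑ a, ∑ b, TensorProduct.map
        (TensorProduct.map (U.act ⁅b, c⁆ ∘ₗ U.1.proj a) (V.act ⁅c⁻¹, a⁻¹⁆ ∘ₗ V.1.proj b))
        (W.act 1 ∘ₗ W.1.proj c) := by
    refine VecG.ext_homog₃ fun a u b v c w hu hv hw => ?_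
    by_cases ha : a ∈ A
    swap
    · rw [← hu, hU a ha]; simp
    by_cases hb : b ∈ A
    swap
    · rw [← hv, hV b hb]; simp
    rw [LinearMap.comp_apply, LinearMap.comp_apply,
      borromean_tmul hA hω U V W hU hV ha hb hu hv hw]
    simp only [LinearMap.sum_apply, TensorProduct.map_tmul, LinearMap.comp_apply,
      VecG.proj_of_homog hu, VecG.proj_of_homog hv, VecG.proj_of_homog hw]
    rw [Finset.sum_eq_single c (by intro _ _ h; simp [h]) (by simp),
      Finset.sum_eq_single a (by intro _ _ h; simp [h]) (by simp),
      Finset.sum_eq_single b (by intro _ _ h; simp [h]) (by simp)]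
    simp [act_one]
  rw [borromeanTensor_eq_trace, h]
  simp only [map_sum, LinearMap.trace_tensorProduct', Finset.mul_sum]
  refine Finset.sum_congr rfl fun c _ => Finset.sum_congr rfl fun a _ =>
    Finset.sum_congr rfl fun b _ => ?_
  exact mul_comm _ _

/-- Simultaneous conjugation of the degrees does not change the contribution of the first two
objects, so it depends on the degree `c` of the third only through its conjugacy class. -/
theorem sum_compTrace_conjBy (hω : ω.IsInflatedFrom A)
    (U V : ZVecG ω) (hU : ∀ d ∉ A, U.1.proj d = 0) (hV : ∀ d ∉ A, V.1.proj d = 0) (s c : G) :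
    ∑ a, ∑ b, U.compTrace ⁅b, conjBy s c⁆ a * V.compTrace ⁅(conjBy s c)⁻¹, a⁻¹⁆ b =
      ∑ a, ∑ b, U.compTrace ⁅b, c⁆ a * V.compTrace ⁅c⁻¹, a⁻¹⁆ b := by
  rw [← Equiv.sum_comp (MulAut.conj s).toEquiv]
  refine Finset.sum_congr rfl fun a _ => ?_
  rw [← Equiv.sum_comp (MulAut.conj s).toEquiv]
  refine Finset.sum_congr rfl fun b _ => ?_
  rw [← compTrace_conjBy hω U hU s _ a, ← compTrace_conjBy hω V hV s _ b]
  have h : ∀ x : G, (MulAut.conj s).toEquiv x = conjBy s x := fun _ => rfl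
  rw [h, h]
  congr 2 <;> simp only [conjBy, commutatorElement_def] <;> group

end ZVecG

theorem mainTheorem5 {G : Type*} [Group G] [Fintype G] [DecidableEq G] (ω : ThreeCocycle G)
    (A : Subgroup G) [A.Normal] (hA : ∀ a ∈ A, ∀ b ∈ A, a * b = b * a)
    (hω : ω.IsInflatedFrom A)
    (g h k : G) (hg : g ∈ A) (hh : h ∈ A)
    (χ₁ : Subgroup.centralizer ({g} : Set G) → ℂ)
    (χ₂ : Subgroup.centralizer ({h} : Set G) → ℂ)
    (χ₃ : Subgroup.centralizer ({k} : Set G) → ℂ)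
    (U V W : ZVecG ω)
    (hU : U.IsSimpleWith g χ₁) (hV : V.IsSimpleWith h χ₂) (hW : W.IsSimpleWith k χ₃)
    (p q : G → G) (hp : ∀ x, IsConj g x → conjBy (p x) g = x)
    (hq : ∀ y, IsConj h y → conjBy (q y) h = y) :
    -- `χ₁` and `χ₂` are ordinary characters
    (∃ ρ : Representation ℂ (Subgroup.centralizer ({g} : Set G)) (U.1.component g),
      (∀ c, ρ c = U.actOn g c) ∧ ∀ c, χ₁ c = ρ.character c) ∧
    (∃ ρ : Representation ℂ (Subgroup.centralizer ({h} : Set G)) (V.1.component h),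
      (∀ c, ρ c = V.actOn h c) ∧ ∀ c, χ₂ c = ρ.character c) ∧
    -- the commutator conditions hold and the cocycle terms are trivial
    (∀ x y, IsConj g x → IsConj h y →
      (⁅⁅k, y⁆, x⁆ = 1 ∧ ⁅⁅y⁻¹, x⁆, k⁆ = 1) ∧
      ω.Omega x y k = 1 ∧
      (ω.alpha y (conjBy k⁻¹ x)⁻¹ x = 1 ∧ ω.alpha x (conjBy y k) k⁻¹ = 1 ∧
        ω.alpha k y⁻¹ (conjBy x y) = 1) ∧
      (ω.alpha g ⁅y, k⁆ (p x) = 1 ∧ ω.alpha g (p x) (conjBy (p x)⁻¹ ⁅y, k⁆) = 1) ∧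
      (ω.alpha h ⁅k⁻¹, x⁻¹⁆ (q y) = 1 ∧
        ω.alpha h (q y) (conjBy (q y)⁻¹ ⁅k⁻¹, x⁻¹⁆) = 1)) ∧
    -- the formula for the Borromean tensor
    ∃ (h₁ : ∀ x y, IsConj g x → IsConj h y →
        conjBy (p x)⁻¹ ⁅y, k⁆ ∈ Subgroup.centralizer ({g} : Set G))
      (h₂ : ∀ x y, IsConj g x → IsConj h y →
        conjBy (q y)⁻¹ ⁅k⁻¹, x⁻¹⁆ ∈ Subgroup.centralizer ({h} : Set G)),
      borromeanTensor U V W =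
        (Nat.card (conjugatesOf k) : ℂ) * χ₃ 1 *
          ∑ x : conjugatesOf g, ∑ y : conjugatesOf h,
            χ₁ ⟨conjBy (p x)⁻¹ ⁅(y : G), k⁆, h₁ x y x.2 y.2⟩ *
              χ₂ ⟨conjBy (q y)⁻¹ ⁅k⁻¹, (x : G)⁻¹⁆, h₂ x y x.2 y.2⟩ := by
  have hUA : ∀ d ∉ A, U.1.proj d = 0 := fun d hd =>
    hU.proj_eq_zero fun h' => hd (mem_of_isConj hg h')
  have hVA : ∀ d ∉ A, V.1.proj d = 0 := fun d hd =>
    hV.proj_eq_zero fun h' => hd (mem_of_isConj hh h')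
  have hcent : ∀ {a b : G}, a ∈ A → b ∈ A → b ∈ Subgroup.centralizer ({a} : Set G) :=
    fun ha hb => Subgroup.mem_centralizer_singleton_iff.2 (hA _ hb _ ha)
  have h₁ : ∀ x y, IsConj g x → IsConj h y →
      conjBy (p x)⁻¹ ⁅y, k⁆ ∈ Subgroup.centralizer ({g} : Set G) := fun x y _ hy =>
    hcent hg (conjBy_mem _ (commutator_mem_left (mem_of_isConj hh hy) k))
  have h₂ : ∀ x y, IsConj g x → IsConj h y →
      conjBy (q y)⁻¹ ⁅k⁻¹, x⁻¹⁆ ∈ Subgroup.centralizer ({h} : Set G) := fun x y hx _ =>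
    hcent hh (conjBy_mem _ (commutator_mem_right k⁻¹ (A.inv_mem (mem_of_isConj hg hx))))
  refine ⟨?_, ?_, fun x y hx hy => ?_, h₁, h₂, ?_⟩
  · obtain ⟨ρ, hρ⟩ := ZVecG.exists_representation hω U hUA g
    exact ⟨ρ, hρ, fun c => by rw [hU.char, ← hρ]; rfl⟩
  · obtain ⟨ρ, hρ⟩ := ZVecG.exists_representation hω V hVA h
    exact ⟨ρ, hρ, fun c => by rw [hV.char, ← hρ]; rfl⟩
  · have hxA := mem_of_isConj hg hx
    have hyA := mem_of_isConj hh hy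
    refine ⟨⟨?_, ?_⟩, hω.Omega_eq_one hxA hyA k,
      ⟨hω.alpha_of_mem hyA _ _, hω.alpha_of_mem hxA _ _,
        hω.alpha_of_mem_left (A.inv_mem hyA) _ _⟩,
      ⟨hω.alpha_of_mem hg _ _, hω.alpha_of_mem hg _ _⟩,
      ⟨hω.alpha_of_mem hh _ _, hω.alpha_of_mem hh _ _⟩⟩
    · exact commutatorElement_eq_one_iff_mul_comm.2 (hA _ (commutator_mem_right k hyA) _ hxA)
    · rw [commutatorElement_eq_one_iff_mul_comm.2 (hA _ (A.inv_mem hyA) _ hxA),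
        commutatorElement_one_left]
  -- Every degree `c` of the third object conjugate to `k` contributes as much as `k` itself.
  · rw [ZVecG.borromeanTensor_eq_sum hA hω U V W hUA hVA]
    have hc : ∀ c, W.compTrace 1 c *
        ∑ a, ∑ b, U.compTrace ⁅b, c⁆ a * V.compTrace ⁅c⁻¹, a⁻¹⁆ b =
        if IsConj k c then χ₃ 1 *
          ∑ a, ∑ b, U.compTrace ⁅b, k⁆ a * V.compTrace ⁅k⁻¹, a⁻¹⁆ b else 0 := fun c => by
      split_ifs with hkc
      · obtain ⟨s, rfl⟩ := isConj_iff.1 hkc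
        change W.compTrace 1 (conjBy s k) * _ = _
        rw [W.compTrace_one_conjBy, ← hW.compTrace_eq]
        exact congrArg _ (ZVecG.sum_compTrace_conjBy hω U V hUA hVA s k)
      · rw [W.compTrace_of_proj_eq_zero (hW.proj_eq_zero hkc), zero_mul]
    rw [Finset.sum_congr rfl fun c _ => hc c, ← Finset.sum_filter, Finset.sum_const, nsmul_eq_mul,
      ← mul_assoc]
    have hcard : (Finset.univ.filter (IsConj k)).card = Nat.card (conjugatesOf k) :=
      (Nat.subtype_card _ fun c => Finset.mem_filter_univ c).symm
    rw [hcard]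
    congr 1
    rw [sum_eq_sum_conjugatesOf g fun a ha => Finset.sum_eq_zero fun b _ => by
      rw [U.compTrace_of_proj_eq_zero (hU.proj_eq_zero ha), zero_mul]]
    refine Finset.sum_congr rfl fun x _ => ?_
    rw [sum_eq_sum_conjugatesOf h fun b hb => by
      rw [V.compTrace_of_proj_eq_zero (hV.proj_eq_zero hb), mul_zero]]
    refine Finset.sum_congr rfl fun y _ => ?_
    -- Move the traces on `U_x` and `V_y` to `U_g` and `V_h` by conjugating with `p x` and `q y`.
    rw [← hU.compTrace_eq, ← hV.compTrace_eq,
      ← ZVecG.compTrace_conjBy hω U hUA (p x) _ g, ← ZVecG.compTrace_conjBy hω V hVA (q y) _ h,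
      conjBy_conjBy_inv, conjBy_conjBy_inv, hp x x.2, hq y y.2]
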